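/- Let $\mathbb B_\omega$ be the partial order on $\omega\times\mathbb Q$ given by $\langle i_1,q_1\rangle<\langle i_2,q_2\rangle$ iff $i_1=i_2$ and $q_1<_{\mathbb Q}q_2$ (so $\mathbb B_\omega$ consists of $\omega$ many disjoint copies of the rational line, elements of different copies being incomparable), and let $\mathbb P(\mathbb B_\omega)$ be the set of all subsets $A$ of $\omega\times\mathbb Q$ which, with the induced order, are isomorphic to $\mathbb B_\omega$. Let $L$ be a linear order which embeds, as an order, into $\langle\mathbb R,<\rangle$ and is complete, that is, has a least element $0_L$ and a greatest element $1_L$ and has no gaps (for each partition of $L$ into nonempty sets $A$ and $B$ with $a<b$ for all $a\in A$, $b\in B$, either $A$ has a greatest element or $B$ has a least element). Suppose that $0_L$ is non-isolated, that is, $L\neq\{0_L\}$ and $0_L$ has no immediate successor in $L$. Then there is a maximal chain in the poset $\langle\mathbb P(\mathbb B_\omega)\cup\{\emptyset\},\subset\rangle$ which is isomorphic to $L$. -/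

import Mathlib

/-- The partial order `𝔹_ω = ω × ℚ`: the disjoint sum of countably many copies of `ℚ`.
The order on the sigma type is Mathlib's disjoint sum order
(`⟨i, p⟩ < ⟨j, q⟩` iff `i = j` and `p < q`). -/
abbrev BOmega : Type := Σ _ : ℕ, ℚ

/-- The set `ℙ(X)` of all subsets of `X` which, with the induced order, are isomorphic to `X`. -/
def copies (X : Type*) [PartialOrder X] : Set (Set X) :=
  {A | Nonempty (A ≃o X)}

/-- `⟨A, B⟩` is a cut of `L`: a partition of `L` into two nonempty pieces, the first one
lying entirely below the second one. -/
def IsCut {L : Type*} [LinearOrder L] (A B : Set L) : Prop :=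
  A.Nonempty ∧ B.Nonempty ∧ A ∪ B = Set.univ ∧ ∀ a ∈ A, ∀ b ∈ B, a < b

/-- `L` has no gaps: in each cut, the lower part has a greatest element or the upper part
has a least element. -/
def HasNoGaps (L : Type*) [LinearOrder L] : Prop :=
  ∀ A B : Set L, IsCut A B → (∃ a, IsGreatest A a) ∨ (∃ b, IsLeast B b)

/-- The least element of `L` is non-isolated (in the order topology): it is not the only
element, and it has no immediate successor. -/
def BotNonIsolated (L : Type*) [LinearOrder L] [OrderBot L] : Prop :=
  Nontrivial L ∧ ∀ x : L, ¬ (⊥ ⋖ x)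

/-! Label the points of `𝔹_ω` injectively by elements of `L` and send `x` to the set of points
labelled below `x`. If these sets are copies for `x > ⊥`, a set comparable with all of them lies
between `{f < z}` and `{f ≤ z}` for a supremum `z`, so equals one of the two. The second is again in
the chain if `z` has a successor; otherwise it must not be a copy, which is ensured by making the
last point maximal in it (`exists_isMaxChain_of_labelling`).

The labels are the countably many jumps `J` together with countable sets `D i` dense in the
jump-free intervals (`exists_disjoint_dense`). They are placed on countably many real lines so that
each initial segment is dense without end points on every line it meets. If the jumps accumulate at
`⊥`, they fill lines of their own densely at every stage (`exists_dense_placement`), and `D 0` keeps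
its order on a separate line. Otherwise some `[⊥, ε)` is jump-free: the sets `D (i + 1)` keep their
order on separate lines, and the jumps are moved down to spare positions below `ε`. -/

theorem HasNoGaps.exists_isLUB {L : Type*} [LinearOrder L] [BoundedOrder L] (h : HasNoGaps L)
    (S : Set L) : ∃ z, IsLUB S z := by
  by_cases hA : ((upperBounds S)ᶜ).Nonempty
  · have hcut : IsCut (upperBounds S)ᶜ (upperBounds S) := by
      refine ⟨hA, ⟨⊤, fun _ _ => le_top⟩, Set.compl_union_self _, fun a ha b hb => ?_⟩
      by_contra hab
      exact ha fun s hs => (hb hs).trans (not_lt.1 hab)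
    rcases h _ _ hcut with ⟨a, ha, hmax⟩ | ⟨b, hb⟩
    · have : ∃ s ∈ S, a < s := by
        by_contra! hcon
        exact ha fun s hs => hcon s hs
      obtain ⟨s, hs, has⟩ := this
      refine ⟨s, IsGreatest.isLUB ⟨hs, ?_⟩⟩
      by_contra hcon
      exact (hmax hcon).not_gt has
    · exact ⟨b, hb⟩
  · rw [Set.not_nonempty_iff_eq_empty, Set.compl_empty_iff] at hA
    exact ⟨⊥, by rw [hA]; trivial, fun _ _ => bot_le⟩

/-! ### Distinct representatives and recognition of copies -/

/-- Countably many infinite sets have a system of distinct representatives. -/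
theorem exists_injective_forall_mem_of_infinite {ι α : Type*} [Countable ι] (T : ι → Set α)
    (hT : ∀ i, (T i).Infinite) : ∃ f : ι → α, Function.Injective f ∧ ∀ i, f i ∈ T i := by
  classical
  obtain ⟨ν, hν⟩ := exists_injective_nat ι
  choose t ht hcard using fun i => (hT i).exists_subset_card_eq (ν i + 1)
  -- Hall's condition: `ν` embeds `s` into `{0, …, ν i}` for the index `i` of largest `ν i`, and `t
  -- i` alone has `ν i + 1` elements.
  obtain ⟨f, hf, hmem⟩ := (Finset.all_card_le_biUnion_card_iff_exists_injective t).1 (by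
    intro s
    rcases s.eq_empty_or_nonempty with rfl | hs
    · simp
    obtain ⟨i, hi, hmax⟩ := s.exists_max_image ν hs
    calc s.card = (s.image ν).card := (Finset.card_image_of_injective s hν).symm
      _ ≤ (Finset.range (ν i + 1)).card := by
        refine Finset.card_le_card fun n hn => ?_
        obtain ⟨j, hj, rfl⟩ := Finset.mem_image.1 hn
        exact Finset.mem_range.2 (Nat.lt_succ_of_le (hmax j hj))
      _ = (t i).card := by rw [Finset.card_range, hcard]
      _ ≤ (s.biUnion t).card := Finset.card_le_card (Finset.subset_biUnion_of_mem t hi))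
  exact ⟨f, hf, fun i => ht i (hmem i)⟩

/-- A countable set in a disjoint sum of real lines is a copy of `𝔹_ω` as soon as infinitely many
of its components are nonempty and all of them are dense without end points. -/
theorem nonempty_orderIso_bOmega (A : Set (Σ _ : ℕ, ℝ)) (hA : A.Countable)
    (hinf : {i | ∃ r, (⟨i, r⟩ : Σ _ : ℕ, ℝ) ∈ A}.Infinite)
    (hmax : ∀ i a, (⟨i, a⟩ : Σ _ : ℕ, ℝ) ∈ A → ∃ b, a < b ∧ (⟨i, b⟩ : Σ _ : ℕ, ℝ) ∈ A)
    (hmin : ∀ i a, (⟨i, a⟩ : Σ _ : ℕ, ℝ) ∈ A → ∃ b, b < a ∧ (⟨i, b⟩ : Σ _ : ℕ, ℝ) ∈ A)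
    (hdense : ∀ i a b, (⟨i, a⟩ : Σ _ : ℕ, ℝ) ∈ A → (⟨i, b⟩ : Σ _ : ℕ, ℝ) ∈ A → a < b →
      ∃ c, a < c ∧ c < b ∧ (⟨i, c⟩ : Σ _ : ℕ, ℝ) ∈ A) :
    Nonempty (A ≃o BOmega) := by
  classical
  set N := {i | ∃ r, (⟨i, r⟩ : Σ _ : ℕ, ℝ) ∈ A}
  have : Infinite N := hinf.to_subtype
  obtain ⟨ν⟩ : Nonempty (ℕ ≃ N) := ⟨(Nat.Subtype.orderIsoOfNat N).toEquiv⟩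
  let K : ℕ → Set ℝ := fun i => {r | (⟨i, r⟩ : Σ _ : ℕ, ℝ) ∈ A}
  have hiso : ∀ i : N, Nonempty (ℚ ≃o K i) := by
    intro i
    have h1 : Countable (K i) :=
      (hA.preimage (f := fun r : ℝ => (⟨(i : ℕ), r⟩ : Σ _ : ℕ, ℝ))
        fun a b h => by simpa using h).to_subtype
    have h2 : Nonempty (K i) := by
      obtain ⟨r, hr⟩ := i.2
      exact ⟨⟨r, hr⟩⟩
    have h3 : NoMaxOrder (K i) := ⟨fun a => by
      obtain ⟨b, hb, hbA⟩ := hmax i a a.2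
      exact ⟨⟨b, hbA⟩, hb⟩⟩
    have h4 : NoMinOrder (K i) := ⟨fun a => by
      obtain ⟨b, hb, hbA⟩ := hmin i a a.2
      exact ⟨⟨b, hbA⟩, hb⟩⟩
    have h5 : DenselyOrdered (K i) := ⟨fun a b hab => by
      obtain ⟨c, hc, hc', hcA⟩ := hdense i a b a.2 b.2 hab
      exact ⟨⟨c, hcA⟩, hc, hc'⟩⟩
    exact Order.iso_of_countable_dense ℚ (K i)
  have φ := fun i => (hiso i).some
  let F : BOmega → A := fun p => ⟨⟨ν p.1, φ (ν p.1) p.2⟩, (φ (ν p.1) p.2).2⟩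
  have hle : ∀ p q, F p ≤ F q ↔ p ≤ q := by
    rintro ⟨i, p⟩ ⟨j, q⟩
    constructor
    · intro h
      have h' : (⟨ν i, φ (ν i) p⟩ : Σ _ : ℕ, ℝ) ≤ ⟨ν j, φ (ν j) q⟩ := h
      have hij : i = j := by
        rw [Sigma.le_def] at h'
        exact ν.injective (Subtype.ext h'.1)
      subst hij
      rw [Sigma.mk_le_mk_iff] at h' ⊢
      exact (φ (ν i)).le_iff_le.1 h'
    · intro h
      have hij : i = j := by
        rw [Sigma.le_def] at h
        exact h.1
      subst hij
      rw [Sigma.mk_le_mk_iff] at h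
      change (⟨ν i, φ (ν i) p⟩ : Σ _ : ℕ, ℝ) ≤ ⟨ν i, φ (ν i) q⟩
      rw [Sigma.mk_le_mk_iff]
      exact (φ (ν i)).le_iff_le.2 h
  have hsurj : Function.Surjective F := by
    rintro ⟨⟨i, r⟩, hr⟩
    obtain ⟨n, hn⟩ := ν.surjective ⟨i, r, hr⟩
    have hi : (ν n : ℕ) = i := by rw [hn]
    subst hi
    refine ⟨⟨n, (φ (ν n)).symm ⟨r, hr⟩⟩, ?_⟩
    simp [F]
  exact ⟨(RelIso.ofSurjective (OrderEmbedding.ofMapLEIff F hle) hsurj).symm⟩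

/-! ### From labellings to maximal chains -/

/-- A labelling of the points of `𝔹_ω` by elements of `L` whose initial segments are copies, with
no copy strictly between consecutive ones, yields a maximal chain isomorphic to `L`. -/
theorem exists_isMaxChain_of_labelling {L : Type*} [LinearOrder L] [BoundedOrder L]
    (hgaps : HasNoGaps L) (f : BOmega → L) (hf : Function.Injective f)
    (hcopy : ∀ x, ⊥ < x → {p | f p < x} ∈ copies BOmega)
    (hlimit : ∀ p, (∀ y, ¬ f p ⋖ y) → {q | f q ≤ f p} ∉ copies BOmega)
    (hdense : ∀ a b, a < b → ∃ p, a ≤ f p ∧ f p < b) :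
    ∃ C : Set ↥(copies BOmega ∪ {∅}), IsMaxChain (· ≤ ·) C ∧ Nonempty (L ≃o C) := by
  have hmem : ∀ x, {p | f p < x} ∈ copies BOmega ∪ {∅} := by
    intro x
    rcases eq_bot_or_bot_lt x with rfl | hx
    · right
      simp
    · exact Or.inl (hcopy x hx)
  let F : L → ↥(copies BOmega ∪ {∅}) := fun x => ⟨{p | f p < x}, hmem x⟩
  have hmono : StrictMono F := by
    intro a b hab
    refine lt_of_le_not_ge (fun p (hp : f p < a) => hp.trans hab) fun hle => ?_
    obtain ⟨p, hap, hpb⟩ := hdense a b hab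
    have : f p < a := hle (show p ∈ {p | f p < b} from hpb)
    exact this.not_ge hap
  have hchain : IsChain (· ≤ ·) (Set.range F) := by
    rintro _ ⟨a, rfl⟩ _ ⟨b, rfl⟩ _
    exact (le_total a b).imp (fun h => hmono.monotone h) fun h => hmono.monotone h
  refine ⟨Set.range F, ⟨hchain, fun t ht hsub => hsub.antisymm fun B hB => ?_⟩,
    ⟨(OrderEmbedding.ofStrictMono F hmono).orderIso⟩⟩
  have htot : ∀ x, F x ≤ B ∨ B ≤ F x := fun x => ht.total (hsub ⟨x, rfl⟩) hB
  obtain ⟨z, hz⟩ := hgaps.exists_isLUB {x | F x ≤ B}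
  have h1 : ∀ p, f p < z → p ∈ B.1 := by
    intro p hp
    obtain ⟨x, hx, hpx⟩ := (lt_isLUB_iff hz).1 hp
    exact hx hpx
  have h2 : ∀ p ∈ B.1, f p ≤ z := by
    intro p hp
    by_contra! hzp
    rcases htot (f p) with h | h
    · exact (hz.1 h).not_gt hzp
    · exact lt_irrefl (f p) (h hp)
  by_cases hp : ∃ p ∈ B.1, f p = z
  · obtain ⟨p, hpB, rfl⟩ := hp
    have hBeq : B.1 = {q | f q ≤ f p} := by
      ext q
      refine ⟨h2 q, fun hq => ?_⟩
      rcases (show f q ≤ f p from hq).lt_or_eq with h | h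
      · exact h1 q h
      · rwa [hf h]
    by_cases hy : ∃ y, f p ⋖ y
    · obtain ⟨y, hy⟩ := hy
      refine ⟨y, Subtype.ext ?_⟩
      rw [hBeq]
      ext q
      exact ⟨fun hq => not_lt.1 fun h => hy.2 h hq, fun hq => lt_of_le_of_lt hq hy.1⟩
    · push Not at hy
      rcases B.2 with h | h
      · exact absurd (hBeq ▸ h) (hlimit p hy)
      · rw [Set.mem_singleton_iff.1 h] at hpB
        exact hpB.elim
  · push Not at hp
    refine ⟨z, Subtype.ext ?_⟩
    ext q
    exact ⟨h1 q, fun hq => (h2 q hq).lt_of_ne (hp q hq)⟩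

theorem snd_lt_snd_of_sigma_lt {ι α : Type*} [LT α] {a b : Σ _ : ι, α} (h : a < b) :
    a.2 < b.2 := by
  obtain ⟨i, r, s, h⟩ := h
  exact h

theorem BOmega.exists_gt (p : BOmega) : ∃ q, p < q := by
  obtain ⟨i, r⟩ := p
  exact ⟨⟨i, r + 1⟩, Sigma.mk_lt_mk_iff.2 (lt_add_one r)⟩

/-- A version of `exists_isMaxChain_of_labelling` in which the labels are placed in a disjoint sum
of real lines. -/
theorem exists_isMaxChain_of_placement {L : Type*} [LinearOrder L] [BoundedOrder L]
    (hgaps : HasNoGaps L) (hbot : (⊥ : L) < ⊤) (V : Set L) (htop : ∀ v ∈ V, v < ⊤)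
    (g : L → Σ _ : ℕ, ℝ) (hg : Set.InjOn g V)
    (hcopy : ∀ x : L, ⊥ < x → Nonempty (↥(g '' {v | v ∈ V ∧ v < x}) ≃o BOmega))
    (hlimit : ∀ v ∈ V, (∀ y, ¬ v ⋖ y) → ∀ w ∈ V, w ≤ v → ¬ g v < g w)
    (hdense : ∀ a b, a < b → ∃ v ∈ V, a ≤ v ∧ v < b) :
    ∃ C : Set ↥(copies BOmega ∪ {∅}), IsMaxChain (· ≤ ·) C ∧ Nonempty (L ≃o C) := by
  obtain ⟨φ⟩ := hcopy ⊤ hbot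
  choose f hfV hgf using fun p : BOmega => (φ.symm p).2
  have hle : ∀ p q, g (f p) ≤ g (f q) ↔ p ≤ q := by
    intro p q
    rw [hgf, hgf]
    exact φ.symm.le_iff_le
  have hsurj : ∀ v ∈ V, ∃ p, f p = v := by
    intro v hv
    refine ⟨φ ⟨g v, v, ⟨hv, htop v hv⟩, rfl⟩, hg (hfV _).1 hv ?_⟩
    rw [hgf]
    simp
  have hfinj : Function.Injective f := by
    intro p q h
    exact le_antisymm ((hle p q).1 (by rw [h])) ((hle q p).1 (by rw [h]))
  refine exists_isMaxChain_of_labelling hgaps f hfinj ?_ ?_ ?_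
  · intro x hx
    obtain ⟨ψ⟩ := hcopy x hx
    let G : {p | f p < x} → ↥(g '' {v | v ∈ V ∧ v < x}) :=
      fun p => ⟨g (f p), f p, ⟨(hfV p).1, p.2⟩, rfl⟩
    have hG : Function.Surjective G := by
      rintro ⟨_, v, ⟨hvV, hv⟩, rfl⟩
      obtain ⟨p, rfl⟩ := hsurj v hvV
      exact ⟨⟨p, hv⟩, rfl⟩
    exact ⟨(RelIso.ofSurjective
      (OrderEmbedding.ofMapLEIff G fun p q => hle p.1 q.1) hG).trans ψ⟩
  · rintro p hp ⟨ψ⟩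
    -- A copy has no maximal element, whereas `hlimit` makes `p` maximal here.
    obtain ⟨q, hq⟩ := BOmega.exists_gt (ψ ⟨p, le_refl (f p)⟩)
    have hlt : (⟨p, le_refl (f p)⟩ : {q | f q ≤ f p}) < ψ.symm q := by
      rwa [← ψ.lt_iff_lt, ψ.apply_symm_apply]
    refine hlimit (f p) (hfV p).1 hp (f (ψ.symm q).1) (hfV _).1 (ψ.symm q).2 ?_
    exact lt_of_le_not_ge ((hle _ _).2 hlt.le) fun h => hlt.not_ge ((hle _ _).1 h)
  · intro a b hab
    obtain ⟨v, hv, h⟩ := hdense a b hab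
    obtain ⟨p, rfl⟩ := hsurj v hv
    exact ⟨p, h⟩

/-! ### Jumps and dense sets of labels -/

/-- Choose one point of `L` in each rational interval meeting the image of `e`; some such interval
contains `e c` and lies between `e a` and `e b`. -/
theorem exists_countable_forall_between {L : Type*} [LinearOrder L] (e : L ↪o ℝ) :
    ∃ E : Set L, E.Countable ∧ ∀ a b c : L, a < c → c < b → ∃ u ∈ E, a < u ∧ u < b := by
  choose s hs using fun r : {r : ℚ × ℚ // ∃ x : L, (r.1 : ℝ) < e x ∧ e x < r.2} => r.2
  refine ⟨Set.range s, Set.countable_range s, fun a b c hac hcb => ?_⟩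
  obtain ⟨p, hap, hpc⟩ := exists_rat_btwn (e.lt_iff_lt.2 hac)
  obtain ⟨q, hcq, hqb⟩ := exists_rat_btwn (e.lt_iff_lt.2 hcb)
  have := hs ⟨(p, q), c, hpc, hcq⟩
  exact ⟨_, ⟨_, rfl⟩, e.lt_iff_lt.1 (hap.trans this.1), e.lt_iff_lt.1 (this.2.trans hqb)⟩

/-- There are no jumps in the interval `[a, b]`. -/
def JumpFree {L : Type*} [LinearOrder L] (a b : L) : Prop :=
  ∀ x, a ≤ x → x < b → ∀ y, ¬ x ⋖ y

theorem JumpFree.mono {L : Type*} [LinearOrder L] {a b c d : L} (h : JumpFree a b) (hac : a ≤ c)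
    (hdb : d ≤ b) : JumpFree c d :=
  fun x hx hx' => h x (hac.trans hx) (hx'.trans_le hdb)

theorem JumpFree.exists_between {L : Type*} [LinearOrder L] {a b : L} (h : JumpFree a b)
    (hab : a < b) : ∃ c, a < c ∧ c < b := by
  by_contra! hcon
  exact h a le_rfl hab b ⟨hab, fun c hac hcb => (hcon c hac).not_gt hcb⟩

theorem JumpFree.infinite_Ioo {L : Type*} [LinearOrder L] {a b : L} (h : JumpFree a b)
    (hab : a < b) : (Set.Ioo a b).Infinite := by
  intro hfin
  obtain ⟨c, hc⟩ := h.exists_between hab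
  obtain ⟨m, hm, hmax⟩ := Set.exists_max_image _ id hfin ⟨c, hc⟩
  obtain ⟨d, hmd, hdb⟩ := (h.mono hm.1.le le_rfl).exists_between hm.2
  exact (hmax d ⟨hm.1.trans hmd, hdb⟩).not_gt hmd

/-- Disjoint countable sets, each dense in every jump-free interval. -/
theorem exists_disjoint_dense {L : Type*} [LinearOrder L] (e : L ↪o ℝ) :
    ∃ D : ℕ → Set L, (∀ i, (D i).Countable) ∧ (∀ i j d, d ∈ D i → d ∈ D j → i = j) ∧
      (∀ a b, a < b → JumpFree a b → ∀ i, ∃ d ∈ D i, a < d ∧ d < b) ∧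
      ∀ i, ∀ d ∈ D i, ∃ u v, u < d ∧ d < v ∧ JumpFree u v := by
  obtain ⟨E, hE, hEb⟩ := exists_countable_forall_between e
  have : Countable E := hE.to_subtype
  -- One representative for each jump-free interval with end points in `E` and each index `i`;
  -- injectivity of `s` makes the sets `D i` disjoint.
  obtain ⟨s, hs, hmem⟩ := exists_injective_forall_mem_of_infinite
    (fun k : {r : E × E // r.1 < r.2 ∧ JumpFree r.1.1 r.2.1} × ℕ =>
      Set.Ioo k.1.1.1.1 k.1.1.2.1) fun k => k.1.2.2.infinite_Ioo k.1.2.1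
  refine ⟨fun i => Set.range fun r => s (r, i), fun i => Set.countable_range _, ?_, ?_, ?_⟩
  · rintro i j _ ⟨r, rfl⟩ ⟨r', h⟩
    exact (congrArg Prod.snd (hs h)).symm
  · intro a b hab h i
    obtain ⟨c, hac, hcb⟩ := h.exists_between hab
    obtain ⟨u, hu, hau, hub⟩ := hEb a b c hac hcb
    obtain ⟨c', huc, hcb'⟩ := (h.mono hau.le le_rfl).exists_between hub
    obtain ⟨v, hv, huv, hvb⟩ := hEb u b c' huc hcb'
    have := hmem (⟨(⟨u, hu⟩, ⟨v, hv⟩), huv, h.mono hau.le hvb.le⟩, i)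
    exact ⟨_, ⟨_, rfl⟩, hau.trans this.1, this.2.trans hvb⟩
  · rintro i _ ⟨r, rfl⟩
    exact ⟨_, _, (hmem (r, i)).1, (hmem (r, i)).2, r.2.2⟩

/-- A rational between the images of `x` and its successor depends strictly monotonically on `x`. -/
theorem countable_setOf_exists_covBy {L : Type*} [LinearOrder L] (e : L ↪o ℝ) :
    {x : L | ∃ y, x ⋖ y}.Countable := by
  choose y hy using fun x : {x : L | ∃ y, x ⋖ y} => x.2
  choose r hr hr' using fun x => exists_rat_btwn (e.lt_iff_lt.2 (hy x).1)
  have hlt : ∀ a b, a < b → r a < r b := by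
    intro a b hab
    have hya : y a ≤ b := not_lt.1 fun h => (hy a).2 hab h
    exact_mod_cast (hr' a).trans_le ((e.le_iff_le.2 hya).trans (hr b).le)
  exact Set.countable_coe_iff.1 (StrictMono.injective (f := r) fun a b => hlt a b).countable

/-- If the jumps accumulate at the least element, then they can be spread over countably many
lines such that the jumps below any `x > ⊥` are dense in every line. -/
theorem exists_dense_placement {L : Type*} [LinearOrder L] [OrderBot L] (E : Set L)
    (hE : E.Countable) (hEbot : ∀ x, ⊥ < x → ∃ u ∈ E, ⊥ < u ∧ u < x) (J : Set L)
    (hJ : J.Countable) (hJbot : ⊥ ∉ J) (hacc : ∀ x, ⊥ < x → ∃ j ∈ J, j < x) :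
    ∃ g : J → Σ _ : ℕ, ℝ, Function.Injective g ∧
      ∀ x, ⊥ < x → ∀ i (p q : ℝ), p < q → ∃ j : J, j.1 < x ∧ ∃ r, p < r ∧ r < q ∧
        g j = ⟨i, r⟩ := by
  have : Countable E := hE.to_subtype
  have : Countable J := hJ.to_subtype
  let I := ℕ × {r : ℚ × ℚ // r.1 < r.2}
  -- Each target (a line and a rational interval) receives, for every `u ∈ E` above `⊥`, its own
  -- jump below `u`.
  obtain ⟨s, hs, hsmem⟩ := exists_injective_forall_mem_of_infinite
    (fun k : I × {u : E // ⊥ < u.1} => {j : J | j.1 < k.2.1.1}) (by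
      rintro ⟨-, ⟨u, hu⟩, hu'⟩
      intro hfin
      obtain ⟨j, hj, hju⟩ := hacc u hu'
      obtain ⟨m, hm, hmin⟩ := Set.exists_min_image _ id hfin ⟨⟨j, hj⟩, hju⟩
      obtain ⟨j', hj', hjm⟩ := hacc m.1 (bot_lt_iff_ne_bot.2 fun h => hJbot (h ▸ m.2))
      exact (hmin ⟨j', hj'⟩ (hjm.trans hm)).not_gt hjm)
  -- Jumps not chosen by `s` may go anywhere, since extra points cannot spoil density.
  let t : J → I := Function.extend s Prod.fst fun _ => (0, ⟨(0, 1), zero_lt_one⟩)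
  obtain ⟨g, hg, hgmem⟩ := exists_injective_forall_mem_of_infinite
    (fun j : J => (fun r : ℝ => (⟨(t j).1, r⟩ : Σ _ : ℕ, ℝ)) ''
      Set.Ioo ((t j).2.1.1 : ℝ) ((t j).2.1.2 : ℝ)) (fun j =>
        (Set.Ioo_infinite (by exact_mod_cast (t j).2.2)).image
          fun a _ b _ h => by simpa using h)
  refine ⟨g, hg, fun x hx i p q hpq => ?_⟩
  obtain ⟨p', hpp, hpq'⟩ := exists_rat_btwn hpq
  obtain ⟨q', hqq, hq'⟩ := exists_rat_btwn hpq'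
  obtain ⟨u, hu, hu', hux⟩ := hEbot x hx
  let k : I × {u : E // ⊥ < u.1} := ((i, ⟨(p', q'), by exact_mod_cast hqq⟩), ⟨⟨u, hu⟩, hu'⟩)
  obtain ⟨r, hr, hgr⟩ := hgmem (s k)
  have ht : t (s k) = k.1 := hs.extend_apply _ _ _
  rw [ht] at hr hgr
  exact ⟨s k, (show (s k).1 < u from hsmem k).trans hux, r, hpp.trans hr.1, hr.2.trans hq',
    hgr.symm⟩

/-! ### The two placements -/

theorem theorem6 (L : Type*) [LinearOrder L] [BoundedOrder L]
    (hR : Nonempty (L ↪o ℝ)) (hgaps : HasNoGaps L) (hbot : BotNonIsolated L) :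
    ∃ C : Set ↥(copies BOmega ∪ {∅}),
      IsMaxChain (· ≤ ·) C ∧ Nonempty (L ≃o C) := by
  classical
  obtain ⟨e⟩ := hR
  obtain ⟨hnt, hbot⟩ := hbot
  obtain ⟨E, hE, hEb⟩ := exists_countable_forall_between e
  obtain ⟨D, hDc, hDdisj, hDdense, hDint⟩ := exists_disjoint_dense e
  set J := {x : L | ∃ y, x ⋖ y}
  have hJc : J.Countable := countable_setOf_exists_covBy e
  have hJbot : ⊥ ∉ J := fun ⟨y, hy⟩ => hbot y hy
  have hDJ : ∀ i, ∀ d ∈ D i, d ∉ J := by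
    rintro i d hd ⟨y, hy⟩
    obtain ⟨u, v, hud, hdv, h⟩ := hDint i d hd
    exact h d hud.le hdv y hy
  have hDgt : ∀ k i y, ∀ d ∈ D k, d < y → ∃ d' ∈ D i, d < d' ∧ d' < y := by
    intro k i y d hd hdy
    obtain ⟨u, v, hud, hdv, h⟩ := hDint k d hd
    obtain ⟨d', hd', h1, h2⟩ := hDdense d (min y v) (lt_min hdy hdv)
      (h.mono hud.le (min_le_right _ _)) i
    exact ⟨d', hd', h1, h2.trans_le (min_le_left _ _)⟩
  have hDlt : ∀ k i, ∀ d ∈ D k, ∃ d' ∈ D i, d' < d := by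
    intro k i d hd
    obtain ⟨u, v, hud, hdv, h⟩ := hDint k d hd
    obtain ⟨d', hd', h1, h2⟩ := hDdense u d hud (h.mono le_rfl hdv.le) i
    exact ⟨d', hd', h2⟩
  have hDtop : ∀ i, ∀ d ∈ D i, d < ⊤ := by
    intro i d hd
    obtain ⟨u, v, hud, hdv, h⟩ := hDint i d hd
    exact hdv.trans_le le_top
  have hJtop : ∀ j ∈ J, j < ⊤ := fun j ⟨y, hy⟩ => hy.1.trans_le le_top
  have hdense : ∀ i a b, a < b → ∃ v ∈ J ∪ D i, a ≤ v ∧ v < b := by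
    intro i a b hab
    by_cases h : JumpFree a b
    · obtain ⟨d, hd, h1, h2⟩ := hDdense a b hab h i
      exact ⟨d, Or.inr hd, h1.le, h2⟩
    · unfold JumpFree at h
      push Not at h
      obtain ⟨x, hax, hxb, y, hy⟩ := h
      exact ⟨x, Or.inl ⟨y, hy⟩, hax, hxb⟩
  by_cases hacc : ∀ x, ⊥ < x → ∃ j ∈ J, j < x
  · have hEbot : ∀ x : L, ⊥ < x → ∃ u ∈ E, ⊥ < u ∧ u < x := by
      intro x hx
      obtain ⟨c, hc, hcx⟩ := (not_covBy_iff hx).1 (hbot x)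
      exact hEb ⊥ x c hc hcx
    obtain ⟨g, hg, hgd⟩ := exists_dense_placement E hE hEbot J hJc hJbot hacc
    -- The shift by one reserves line `0` for `D 0`, so a label without successor shares its line
    -- only with labels in their original order.
    let G : L → Σ _ : ℕ, ℝ := fun v =>
      if h : v ∈ J then ⟨(g ⟨v, h⟩).1 + 1, (g ⟨v, h⟩).2⟩ else ⟨0, e v⟩
    have hGJ : ∀ j : J, G j = ⟨(g j).1 + 1, (g j).2⟩ := fun j => dif_pos j.2
    have hGD : ∀ v ∉ J, G v = ⟨0, e v⟩ := fun v hv => dif_neg hv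
    refine exists_isMaxChain_of_placement hgaps bot_lt_top (J ∪ D 0) ?_ G ?_ ?_ ?_ (hdense 0)
    · rintro v (hv | hv)
      exacts [hJtop v hv, hDtop 0 v hv]
    · intro v _ w _ hvw
      by_cases hv : v ∈ J <;> by_cases hw : w ∈ J
      · rw [hGJ ⟨v, hv⟩, hGJ ⟨w, hw⟩] at hvw
        have : g ⟨v, hv⟩ = g ⟨w, hw⟩ := by
          simp only [Sigma.mk.injEq, heq_eq_eq, Nat.add_right_cancel_iff] at hvw
          exact Sigma.ext hvw.1 (heq_of_eq hvw.2)
        exact congrArg Subtype.val (hg this)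
      · rw [hGJ ⟨v, hv⟩, hGD w hw] at hvw
        simp at hvw
      · rw [hGD v hv, hGJ ⟨w, hw⟩] at hvw
        simp at hvw
      · rw [hGD v hv, hGD w hw] at hvw
        simpa using hvw
    · intro x hx
      have h0 : ∀ a, (⟨0, a⟩ : Σ _ : ℕ, ℝ) ∈ G '' {v | v ∈ J ∪ D 0 ∧ v < x} →
          ∃ d ∈ D 0, d < x ∧ e d = a := by
        rintro a ⟨v, ⟨hv, hvx⟩, hva⟩
        by_cases hvJ : v ∈ J
        · rw [hGJ ⟨v, hvJ⟩] at hva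
          simp at hva
        · rw [hGD v hvJ] at hva
          exact ⟨v, hv.resolve_left hvJ, hvx, by simpa using hva⟩
      have h0' : ∀ d ∈ D 0, d < x →
          (⟨0, e d⟩ : Σ _ : ℕ, ℝ) ∈ G '' {v | v ∈ J ∪ D 0 ∧ v < x} := fun d hd hdx =>
        ⟨d, ⟨Or.inr hd, hdx⟩, hGD d (hDJ 0 d hd)⟩
      have hs : ∀ i (p q : ℝ), p < q → ∃ r, p < r ∧ r < q ∧
          (⟨i + 1, r⟩ : Σ _ : ℕ, ℝ) ∈ G '' {v | v ∈ J ∪ D 0 ∧ v < x} := by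
        intro i p q hpq
        obtain ⟨j, hjx, r, hpr, hrq, hgj⟩ := hgd x hx i p q hpq
        exact ⟨r, hpr, hrq, j, ⟨Or.inl j.2, hjx⟩, by rw [hGJ, hgj]⟩
      refine nonempty_orderIso_bOmega _
        (((hJc.union (hDc 0)).mono fun v hv => hv.1).image G) ?_ ?_ ?_ ?_
      · refine Set.infinite_of_injective_forall_mem (f := Nat.succ) Nat.succ_injective fun i => ?_
        obtain ⟨r, -, -, hr⟩ := hs i 0 1 one_pos
        exact ⟨r, hr⟩
      · rintro (_ | i) a ha
        · obtain ⟨d, hd, hdx, rfl⟩ := h0 a ha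
          obtain ⟨d', hd', h1, h2⟩ := hDgt 0 0 x d hd hdx
          exact ⟨e d', e.lt_iff_lt.2 h1, h0' d' hd' h2⟩
        · obtain ⟨r, h1, h2, hr⟩ := hs i a (a + 1) (lt_add_one a)
          exact ⟨r, h1, hr⟩
      · rintro (_ | i) a ha
        · obtain ⟨d, hd, hdx, rfl⟩ := h0 a ha
          obtain ⟨d', hd', h1⟩ := hDlt 0 0 d hd
          exact ⟨e d', e.lt_iff_lt.2 h1, h0' d' hd' (h1.trans hdx)⟩
        · obtain ⟨r, h1, h2, hr⟩ := hs i (a - 1) a (sub_one_lt a)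
          exact ⟨r, h2, hr⟩
      · rintro (_ | i) a b ha hb hab
        · obtain ⟨d, hd, hdx, rfl⟩ := h0 a ha
          obtain ⟨w, hw, hwx, rfl⟩ := h0 b hb
          obtain ⟨d', hd', h1, h2⟩ := hDgt 0 0 w d hd (e.lt_iff_lt.1 hab)
          exact ⟨e d', e.lt_iff_lt.2 h1, e.lt_iff_lt.2 h2, h0' d' hd' (h2.trans hwx)⟩
        · exact hs i a b hab
    · intro v hv hvy w hw hwv hlt
      have hvJ : v ∉ J := fun ⟨y, hy⟩ => hvy y hy
      rw [hGD v hvJ] at hlt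
      by_cases hwJ : w ∈ J
      · rw [hGJ ⟨w, hwJ⟩, Sigma.lt_def] at hlt
        exact absurd hlt.1 (Nat.succ_ne_zero _).symm
      · rw [hGD w hwJ, Sigma.mk_lt_mk_iff, e.lt_iff_lt] at hlt
        exact hlt.not_ge hwv
  · push Not at hacc
    obtain ⟨ε, hε, hJε⟩ := hacc
    have hfree : JumpFree ⊥ ε := fun x _ hxε y hy => (hJε x ⟨y, hy⟩).not_gt hxε
    have : Countable J := hJc.to_subtype
    -- In this case `D 0` supplies no labels, only positions below `ε` for the jumps.
    obtain ⟨h, hh, hmem⟩ := exists_injective_forall_mem_of_infinite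
      (fun _ : J => {d | d ∈ D 0 ∧ d < ε}) (fun _ hfin => by
        obtain ⟨d, hd, -, hdε⟩ := hDdense ⊥ ε hε hfree 0
        obtain ⟨m, hm, hmax⟩ := Set.exists_max_image _ id hfin ⟨d, hd, hdε⟩
        obtain ⟨d', hd', h1, h2⟩ := hDgt 0 0 ε m hm.1 hm.2
        exact (hmax d' ⟨hd', h2⟩).not_gt h1)
    have hclass : ∀ d, ∃ k, ∀ i, d ∈ D (i + 1) → k = i := by
      intro d
      by_cases hd : ∃ i, d ∈ D (i + 1)
      · obtain ⟨k, hk⟩ := hd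
        exact ⟨k, fun i hi => Nat.succ_injective (hDdisj _ _ d hk hi)⟩
      · exact ⟨0, fun i hi => absurd ⟨i, hi⟩ hd⟩
    choose c hc using hclass
    let w : L → L := fun v => if hv : v ∈ J then h ⟨v, hv⟩ else v
    have hwJ : ∀ j : J, w j = h j := fun j => dif_pos j.2
    have hwD : ∀ v ∉ J, w v = v := fun v hv => dif_neg hv
    let G : L → Σ _ : ℕ, ℝ := fun v => ⟨if v ∈ J then 0 else c v, e (w v)⟩
    -- Labels only move down: positions of labels below `x` stay below `x`, and no label `≤ v` lands
    -- above a non-jump `v`.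
    have hwle : ∀ v, w v ≤ v := by
      intro v
      by_cases hv : v ∈ J
      · rw [hwJ ⟨v, hv⟩]
        exact (hmem _).2.le.trans (hJε v hv)
      · exact (hwD v hv).le
    have hwmem : ∀ v ∈ J ∪ ⋃ i, D (i + 1), ∃ k, w v ∈ D k := by
      intro v hv
      by_cases hvJ : v ∈ J
      · exact ⟨0, by rw [hwJ ⟨v, hvJ⟩]; exact (hmem _).1⟩
      · obtain ⟨i, hi⟩ := Set.mem_iUnion.1 (hv.resolve_left hvJ)
        exact ⟨i + 1, by rwa [hwD v hvJ]⟩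
    have hne : ∀ u (hu : u ∈ J), ∀ v ∈ J ∪ ⋃ i, D (i + 1), v ∉ J → h ⟨u, hu⟩ ≠ v := by
      intro u hu v hv hvJ huv
      obtain ⟨i, hi⟩ := Set.mem_iUnion.1 (hv.resolve_left hvJ)
      exact Nat.succ_ne_zero i (hDdisj _ _ v hi (huv ▸ (hmem ⟨u, hu⟩).1))
    refine exists_isMaxChain_of_placement hgaps bot_lt_top (J ∪ ⋃ i, D (i + 1)) ?_ G ?_ ?_ ?_ ?_
    · rintro v (hv | hv)
      · exact hJtop v hv
      · obtain ⟨i, hi⟩ := Set.mem_iUnion.1 hv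
        exact hDtop _ v hi
    · intro u hu v hv huv
      have huv : w u = w v := by
        simp only [G, Sigma.mk.injEq, heq_eq_eq, e.eq_iff_eq] at huv
        exact huv.2
      by_cases huJ : u ∈ J <;> by_cases hvJ : v ∈ J
      · rw [hwJ ⟨u, huJ⟩, hwJ ⟨v, hvJ⟩] at huv
        exact congrArg Subtype.val (hh huv)
      · rw [hwJ ⟨u, huJ⟩, hwD v hvJ] at huv
        exact absurd huv (hne u huJ v hv hvJ)
      · rw [hwD u huJ, hwJ ⟨v, hvJ⟩] at huv
        exact absurd huv.symm (hne v hvJ u hu huJ)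
      · rwa [hwD u huJ, hwD v hvJ] at huv
    · intro x hx
      have hin : ∀ i a, (⟨i, a⟩ : Σ _ : ℕ, ℝ) ∈ G '' {v | v ∈ J ∪ ⋃ i, D (i + 1) ∧ v < x} →
          ∃ k, ∃ d ∈ D k, d < x ∧ e d = a := by
        rintro i a ⟨v, ⟨hv, hvx⟩, hva⟩
        obtain ⟨k, hk⟩ := hwmem v hv
        simp only [G, Sigma.mk.injEq, heq_eq_eq] at hva
        exact ⟨k, w v, hk, (hwle v).trans_lt hvx, hva.2⟩
      have hin' : ∀ i, ∀ d ∈ D (i + 1), d < x →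
          (⟨i, e d⟩ : Σ _ : ℕ, ℝ) ∈ G '' {v | v ∈ J ∪ ⋃ i, D (i + 1) ∧ v < x} := by
        intro i d hd hdx
        refine ⟨d, ⟨Or.inr (Set.mem_iUnion.2 ⟨i, hd⟩), hdx⟩, ?_⟩
        simp only [G]
        rw [if_neg (hDJ _ d hd), hc d i hd, hwD d (hDJ _ d hd)]
      refine nonempty_orderIso_bOmega _ (((hJc.union (Set.countable_iUnion fun i =>
        hDc (i + 1))).mono fun v hv => hv.1).image G) ?_ ?_ ?_ ?_
      · refine Set.infinite_of_injective_forall_mem (f := id) Function.injective_id fun i => ?_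
        -- Every line is met already below `min ε x`, where there are no jumps.
        obtain ⟨d, hd, -, hdx⟩ := hDdense ⊥ (min ε x) (lt_min hε hx)
          (hfree.mono le_rfl (min_le_left _ _)) (i + 1)
        exact ⟨e d, hin' i d hd (hdx.trans_le (min_le_right _ _))⟩
      · intro i a ha
        obtain ⟨k, d, hd, hdx, rfl⟩ := hin i a ha
        -- The position `d` may be that of a moved jump (`k = 0`), yet points of `D (i + 1)` still
        -- follow it closely.
        obtain ⟨d', hd', h1, h2⟩ := hDgt k (i + 1) x d hd hdx
        exact ⟨e d', e.lt_iff_lt.2 h1, hin' i d' hd' h2⟩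
      · intro i a ha
        obtain ⟨k, d, hd, hdx, rfl⟩ := hin i a ha
        obtain ⟨d', hd', h1⟩ := hDlt k (i + 1) d hd
        exact ⟨e d', e.lt_iff_lt.2 h1, hin' i d' hd' (h1.trans hdx)⟩
      · intro i a b ha hb hab
        obtain ⟨k, d, hd, hdx, rfl⟩ := hin i a ha
        obtain ⟨-, u, -, hux, rfl⟩ := hin i b hb
        obtain ⟨d', hd', h1, h2⟩ := hDgt k (i + 1) u d hd (e.lt_iff_lt.1 hab)
        exact ⟨e d', e.lt_iff_lt.2 h1, e.lt_iff_lt.2 h2, hin' i d' hd' (h2.trans hux)⟩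
    · intro v hv hvy u hu huv hlt
      have hvJ : v ∉ J := fun ⟨y, hy⟩ => hvy y hy
      have hlt' : w v < w u := e.lt_iff_lt.1 (snd_lt_snd_of_sigma_lt hlt)
      rw [hwD v hvJ] at hlt'
      exact hlt'.not_ge ((hwle u).trans huv)
    · intro a b hab
      obtain ⟨v, hv, hv'⟩ := hdense 1 a b hab
      exact ⟨v, hv.imp_right fun hv => Set.mem_iUnion.2 ⟨0, hv⟩, hv'⟩
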